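/- Let $G=(V,E)$ be a finite simple undirected graph, not necessarily connected, with $n=|V|$ processes, one of which is the root $r$, and let every edge $\{u,v\}$ have a strictly positive real weight $\omega(u,v)$. Let $\Gamma(u)$ be the set of neighbors of $u$, let $V_u$ be the connected component of $u$, and let $n_{\mathrm{maxCC}}$ be the maximum number of non-root processes in a connected component of $G$. Processes designate their neighbors by local labels from a set $Lbl$ (distinct neighbors of a process have distinct labels there); below, neighbors are identified with their labels. Algorithm RSP: in a configuration, every process $u\neq r$ has a status $st_u\in\{I,C,EB,EF\}$, a parent pointer $par_u\in Lbl$ (not necessarily the label of a neighbor) and a distance value $d_u\in[0,\infty)$, all arbitrary initially; the root has the constants $st_r=C$, $par_r=\bot$ (with $\bot\notin Lbl$), $d_r=0$. Put $$\begin{aligned} children(u)&=\{v\in\Gamma(u): st_u\ne I,\ st_v\neq I,\ par_v=u,\ d_v\ge d_u+\omega(v,u),\ (st_v=st_u\text{ or }st_u=EB)\},\\ abRoot(u)&\equiv st_u\neq I\wedge\bigl[par_u\notin\Gamma(u)\vee st_{par_u}=I\vee d_u<d_{par_u}+\omega(u,par_u)\vee(st_u\ne st_{par_u}\wedge st_{par_u}\neq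 EB)\bigr],\\ P_{reset}(u)&\equiv st_u=EF\wedge abRoot(u),\\ P_{corr}(u)&\equiv \exists v\in\Gamma(u):\ st_v=C\wedge d_v+\omega(u,v)<d_u. \end{aligned}$$ The macro $computePath(u)$ sets $par_u$ to some $v\in\Gamma(u)$ with $st_v=C$ minimizing $d_v+\omega(u,v)$ among these, then $d_u:=d_{par_u}+\omega(u,par_u)$ and $st_u:=C$. The rules of a process $u\ne r$ are (the root has none): - $R_C$: if $st_u=C$ and $P_{corr}(u)$, then $computePath(u)$; - $R_{EB}$: if $st_u=C$, not $P_{corr}(u)$, and ($abRoot(u)$ or $st_{par_u}=EB$), then $st_u:=EB$; - $R_{EF}$: if $st_u=EB$ and every $v\in children(u)$ has $st_v=EF$, then $st_u:=EF$; - $R_I$: if $P_{reset}(u)$ and no $v\in\Gamma(u)$ has $st_v=C$, then $st_u:=I$; - $R_R$: if ($P_{reset}(u)$ or $st_u=I$) and some $v\in\Gamma(u)$ has $st_v=C$, then $computePath(u)$. In a step, every process of some non-empty set of enabled processes (those for which the guard of some rule holds) atomically executes one of its enabled rules (distributed unfair daemon). An execution is a maximal sequence of configurations linked by steps, from an arbitrary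 initial configuration; a configuration is terminal if no process is enabled. A configuration is legitimate if every $u\in V_r\setminus\{r\}$ has $st_u=C$, $par_u\in\Gamma(u)$ and $d_u=d(u,r)=d_{par_u}+\omega(u,par_u)$, where $d(u,r)$ is the minimum weight of a path from $u$ to $r$, and every $u\notin V_r$ has $st_u=I$. The stabilization time in steps is the maximum, over all executions, of the number of steps needed to reach a terminal legitimate configuration. **Corollary.** If all edges have the same weight, then the stabilization time in steps of Algorithm RSP is at most $$(n_{\mathrm{maxCC}}^3+2\,n_{\mathrm{maxCC}}+3)(n-1),$$ and this bound is at most $n^4$ for all $n\ge 2$. -/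

import Mathlib

open scoped NNReal ENNReal

namespace RSP

/-- The status of a process: Isolated, Correct, Error Broadcast, Error Feedback. -/
inductive Status : Type
  | I
  | C
  | EB
  | EF

/-- The names of the five rules. -/
inductive Rule : Type
  | RC
  | REB
  | REF
  | RI
  | RR

/-- A semi-anonymous network: a simple undirected graph (possibly disconnected) with a
distinguished root, strictly positive edge weights, and at every process `u` a local labeling
`lab u` of the neighbors of `u` by elements of the datatype `Lbl`. -/
structure Network (V Lbl : Type*) where
  graph : SimpleGraph V
  root : V
  weight : Sym2 V → ℝ≥0
  weight_pos : ∀ e ∈ graph.edgeSet, 0 < weight e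
  lab : V → V → Lbl
  lab_injOn : ∀ u : V, Set.InjOn (lab u) (graph.neighborSet u)

/-- A configuration: the variables `st`, `par`, `d` of every process. Those of the root are
constant, and the parent pointer `none` (that is, `⊥`) is the one of the root only; every other
process has an arbitrary element of `Lbl`, which need not be the label of a neighbor. -/
structure Config {V Lbl : Type*} (N : Network V Lbl) where
  st : V → Status
  par : V → Option Lbl
  d : V → ℝ≥0
  st_root : st N.root = Status.C
  d_root : d N.root = 0
  par_eq_none_iff : ∀ u : V, par u = none ↔ u = N.root

variable {V Lbl : Type*}

namespace Network

/-- The weight `ω(u,v)` of the edge `{u,v}`. -/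
def ω (N : Network V Lbl) (u v : V) : ℝ≥0 := N.weight s(u, v)

/-- The connected component `V_u` of `u`. -/
def component (N : Network V Lbl) (u : V) : Set V := {v | N.graph.Reachable u v}

/-- The maximum number of non-root processes in a connected component. -/
noncomputable def nMaxCC [Fintype V] (N : Network V Lbl) : ℕ :=
  Finset.univ.sup fun u : V => (N.component u \ {N.root}).ncard

/-- The weight of a path: the sum of its edge weights. -/
noncomputable def pathWeight (N : Network V Lbl) {u v : V} (p : N.graph.Walk u v) : ℝ≥0 :=
  (p.edges.map N.weight).sum

/-- The weighted distance: the minimum weight of a path, and `∞` if there is none. (Edge weights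
being positive, it does not matter whether a path may visit a process several times.) -/
noncomputable def wdist (N : Network V Lbl) (u v : V) : ℝ≥0∞ :=
  ⨅ p : N.graph.Walk u v, (N.pathWeight p : ℝ≥0∞)

end Network

namespace Config

variable {N : Network V Lbl}

/-- The parent pointer of `u` designates its neighbor `v`. -/
def PointsTo (γ : Config N) (u v : V) : Prop :=
  N.graph.Adj u v ∧ γ.par u = some (N.lab u v)

/-- The macro `children(u)`. -/
def children (γ : Config N) (u : V) : Set V :=
  {v | N.graph.Adj u v ∧ γ.st u ≠ Status.I ∧ γ.st v ≠ Status.I ∧ γ.PointsTo v u ∧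
    γ.d u + N.ω v u ≤ γ.d v ∧ (γ.st v = γ.st u ∨ γ.st u = Status.EB)}

/-- The predicate `abRoot(u)`: `u` is not isolated, and its parent pointer does not designate a
neighbor or the state of `u` is inconsistent with that of the designated neighbor `v`. -/
def AbRoot (γ : Config N) (u : V) : Prop :=
  γ.st u ≠ Status.I ∧
    ((¬ ∃ v, γ.PointsTo u v) ∨
      ∃ v, γ.PointsTo u v ∧
        (γ.st v = Status.I ∨ γ.d u < γ.d v + N.ω u v ∨
          (γ.st u ≠ γ.st v ∧ γ.st v ≠ Status.EB)))

/-- The predicate `P_reset(u)`. -/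
def PReset (γ : Config N) (u : V) : Prop :=
  γ.st u = Status.EF ∧ γ.AbRoot u

/-- The predicate `P_correction(u)`. -/
def PCorrection (γ : Config N) (u : V) : Prop :=
  ∃ v, N.graph.Adj u v ∧ γ.st v = Status.C ∧ γ.d v + N.ω u v < γ.d u

/-- The guard of each rule at process `u`. The root has no rule. -/
def Guard (γ : Config N) (u : V) (ρ : Rule) : Prop :=
  u ≠ N.root ∧
    match ρ with
    | Rule.RC => γ.st u = Status.C ∧ γ.PCorrection u
    | Rule.REB => γ.st u = Status.C ∧ ¬ γ.PCorrection u ∧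
        (γ.AbRoot u ∨ ∃ v, γ.PointsTo u v ∧ γ.st v = Status.EB)
    | Rule.REF => γ.st u = Status.EB ∧ ∀ v ∈ γ.children u, γ.st v = Status.EF
    | Rule.RI => γ.PReset u ∧ ∀ v, N.graph.Adj u v → γ.st v ≠ Status.C
    | Rule.RR => (γ.PReset u ∨ γ.st u = Status.I) ∧
        ∃ v, N.graph.Adj u v ∧ γ.st v = Status.C

/-- `v` is an `argmin` of `d_v + ω(u,v)` among the neighbors of `u` with status `C`. -/
def IsBestNeighbor (γ : Config N) (u v : V) : Prop :=
  N.graph.Adj u v ∧ γ.st v = Status.C ∧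
    ∀ w, N.graph.Adj u w → γ.st w = Status.C → γ.d v + N.ω u v ≤ γ.d w + N.ω u w

/-- The variables of `u` in `γ'` result from the macro `computePath(u)` executed in `γ`. Ties in
the `argmin` may be broken in any way. -/
def ComputePath (γ γ' : Config N) (u : V) : Prop :=
  ∃ v, γ.IsBestNeighbor u v ∧ γ'.par u = some (N.lab u v) ∧
    γ'.d u = γ.d v + N.ω u v ∧ γ'.st u = Status.C

/-- The variables of `u` in `γ'` result from those in `γ` by the assignment `st_u := s`. -/
def SetStatus (γ γ' : Config N) (u : V) (s : Status) : Prop :=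
  γ'.st u = s ∧ γ'.par u = γ.par u ∧ γ'.d u = γ.d u

/-- The variables of `u` in `γ'` result from the action of the rule `ρ` executed by `u` in `γ`. -/
def Action (γ γ' : Config N) (u : V) (ρ : Rule) : Prop :=
  match ρ with
  | Rule.RC => γ.ComputePath γ' u
  | Rule.REB => γ.SetStatus γ' u Status.EB
  | Rule.REF => γ.SetStatus γ' u Status.EF
  | Rule.RI => γ.SetStatus γ' u Status.I
  | Rule.RR => γ.ComputePath γ' u

/-- Process `u` is enabled. -/
def Enabled (γ : Config N) (u : V) : Prop := ∃ ρ, γ.Guard u ρ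

/-- No process is enabled. -/
def Terminal (γ : Config N) : Prop := ∀ u, ¬ γ.Enabled u

/-- A step under the distributed unfair daemon: every process of some non-empty set `X` of enabled
processes atomically executes one of its enabled rules; the other processes do not change. -/
def Step (γ γ' : Config N) : Prop :=
  ∃ X : Set V, X.Nonempty ∧
    (∀ u ∈ X, ∃ ρ, γ.Guard u ρ ∧ γ.Action γ' u ρ) ∧
    ∀ u, u ∉ X → γ'.st u = γ.st u ∧ γ'.par u = γ.par u ∧ γ'.d u = γ.d u

/-- Process `u` is in a legitimate state. -/
def LegitimateState (γ : Config N) (u : V) : Prop :=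
  u = N.root ∨
  (u ≠ N.root ∧ u ∈ N.component N.root ∧ γ.st u = Status.C ∧
    (γ.d u : ℝ≥0∞) = N.wdist u N.root ∧
    ∃ v, γ.PointsTo u v ∧ γ.d u = γ.d v + N.ω u v) ∨
  (u ∉ N.component N.root ∧ γ.st u = Status.I)

/-- A legitimate configuration: every process is in a legitimate state. -/
def Legitimate (γ : Config N) : Prop := ∀ u, γ.LegitimateState u

end Config

/-- An execution: a maximal sequence of configurations `conf 0, conf 1, …` linked by steps. It
consists of `len` steps; it is infinite if `len = ⊤`, and otherwise ends at the terminal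
configuration `conf len` (the values of `conf` after `len` are irrelevant). -/
structure Execution (N : Network V Lbl) where
  len : ℕ∞
  conf : ℕ → Config N
  step : ∀ i : ℕ, (i : ℕ∞) < len → (conf i).Step (conf (i + 1))
  maximal : ∀ i : ℕ, (i : ℕ∞) = len → (conf i).Terminal

/-- The number of steps after which an execution first reaches a configuration that is terminal
and legitimate (`⊤` if it never does). -/
noncomputable def Execution.stepsToStabilize {N : Network V Lbl} (e : Execution N) : ℕ∞ :=
  ⨅ (i : ℕ) (_ : (i : ℕ∞) ≤ e.len ∧ (e.conf i).Terminal ∧ (e.conf i).Legitimate), (i : ℕ∞)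

/-- The stabilization time in steps: the maximum, over all executions from all initial
configurations, of the number of steps to reach a terminal legitimate configuration. -/
noncomputable def stabilizationTime (N : Network V Lbl) : ℕ∞ :=
  ⨆ e : Execution N, e.stepsToStabilize

end RSP

namespace RSP

variable {V Lbl : Type*} {N : Network V Lbl}

/-! Fix a non-root process u; let m bound the number of non-root processes in its component. Alive
abnormal roots are never created (`WeakStep.aliveRoot`), so time splits into segments in which the
component loses none of them, except in the last step. There is at most one more segment than there
are initial alive roots.

Within a segment, u runs at most once through the cycle: resettable `EF`, `I`, `C`, `EB`, frozen
`EF` (`phase`), because an error broadcast hanging from an alive root cannot be reset before some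
alive root vanishes. Hence at most 3 status moves. Once u has status `C` its distance never grows,
so its path moves write distinct distances. With a common weight w, each is d_s + |S| w, where S is
a set of processes other than u and d_s is the distance of some s in S at the start of the segment
(`Segment.exists_origin_of_pathMove`). If S contains the root, then s is the root: m values.
Otherwise there are (m-1)^2 values.

So u moves at most m + (m-1)^2 + 3 times per segment, and at most twice in a segment that it begins
as an alive root. This leaves at most m full segments, whence the cubic bound. Every step moves one
of n-1 processes, so executions are finite, and their terminal configurations are legitimate
(`Terminal.legitimate`). -/

theorem Network.ω_pos (N : Network V Lbl) {u v : V} (h : N.graph.Adj u v) : 0 < N.ω u v :=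
  N.weight_pos _ h

/-! ### Parent pointers and the effect of a single step -/

namespace Config

theorem PointsTo.unique {γ : Config N} {u v w : V} (hv : γ.PointsTo u v) (hw : γ.PointsTo u w) :
    v = w := by
  apply N.lab_injOn u hv.1 hw.1
  simpa using hv.2.symm.trans hw.2

theorem PointsTo.congr {γ γ' : Config N} {u v : V} (h : γ.PointsTo u v)
    (hp : γ'.par u = γ.par u) : γ'.PointsTo u v := ⟨h.1, hp.trans h.2⟩

/-- What it means for `u` not to be an abnormal root, in terms of its parent `v`. -/
theorem not_abRoot_of_parent {γ : Config N} {u v : V} (h : γ.PointsTo u v)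
    (hI : γ.st v ≠ Status.I) (hd : γ.d v + N.ω u v ≤ γ.d u)
    (hs : γ.st u = γ.st v ∨ γ.st v = Status.EB) : ¬ γ.AbRoot u := by
  rintro ⟨-, hn | ⟨w, hw, h1 | h1 | h1⟩⟩
  · exact hn ⟨v, h⟩
  all_goals obtain rfl := h.unique hw
  · exact hI h1
  · exact absurd hd (not_le.2 h1)
  · tauto

theorem exists_parent_of_not_abRoot {γ : Config N} {u : V} (hI : γ.st u ≠ Status.I)
    (h : ¬ γ.AbRoot u) : ∃ v, γ.PointsTo u v ∧ γ.st v ≠ Status.I ∧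
      γ.d v + N.ω u v ≤ γ.d u ∧ (γ.st u = γ.st v ∨ γ.st v = Status.EB) := by
  simp only [AbRoot, not_and, not_or, not_not] at h
  obtain ⟨⟨v, hv⟩, h2⟩ := h hI
  refine ⟨v, hv, ?_⟩
  by_contra hc
  refine h2 ⟨v, hv, ?_⟩
  by_contra hd
  push Not at hd
  exact hc ⟨hd.1, hd.2.1, or_iff_not_imp_left.2 hd.2.2⟩

/-- `u` executes `R_C` or `R_R`. -/
def PathMove (γ γ' : Config N) (u : V) : Prop :=
  (γ.Guard u Rule.RC ∨ γ.Guard u Rule.RR) ∧ γ.ComputePath γ' u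

/-- `u` executes `R_EB`, `R_EF` or `R_I`. -/
def StatusMove (γ γ' : Config N) (u : V) : Prop :=
  (γ.Guard u Rule.REB ∧ γ.SetStatus γ' u Status.EB) ∨
  (γ.Guard u Rule.REF ∧ γ.SetStatus γ' u Status.EF) ∨
  (γ.Guard u Rule.RI ∧ γ.SetStatus γ' u Status.I)

/-- `u` executes one of its rules. -/
def Move (γ γ' : Config N) (u : V) : Prop := γ.PathMove γ' u ∨ γ.StatusMove γ' u

/-- The variables of `u` are the same in both configurations. -/
def Same (γ γ' : Config N) (u : V) : Prop :=
  γ'.st u = γ.st u ∧ γ'.par u = γ.par u ∧ γ'.d u = γ.d u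

/-- A step, except that possibly no process moves. -/
def WeakStep (γ γ' : Config N) : Prop := ∀ u, γ.Move γ' u ∨ γ.Same γ' u

theorem move_of_action {γ γ' : Config N} {u : V} {ρ : Rule} (hg : γ.Guard u ρ)
    (ha : γ.Action γ' u ρ) : γ.Move γ' u := by
  cases ρ
  · exact Or.inl ⟨Or.inl hg, ha⟩
  · exact Or.inr (Or.inl ⟨hg, ha⟩)
  · exact Or.inr (Or.inr (Or.inl ⟨hg, ha⟩))
  · exact Or.inr (Or.inr (Or.inr ⟨hg, ha⟩))
  · exact Or.inl ⟨Or.inr hg, ha⟩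

theorem Step.weakStep {γ γ' : Config N} (h : γ.Step γ') : γ.WeakStep γ' := by
  obtain ⟨X, -, h1, h2⟩ := h
  intro u
  by_cases hu : u ∈ X
  · obtain ⟨ρ, hg, ha⟩ := h1 u hu
    exact Or.inl (move_of_action hg ha)
  · exact Or.inr (h2 u hu)

theorem Step.exists_move {γ γ' : Config N} (h : γ.Step γ') : ∃ u, γ.Move γ' u := by
  obtain ⟨X, ⟨u, hu⟩, h1, -⟩ := h
  obtain ⟨ρ, hg, ha⟩ := h1 u hu
  exact ⟨u, move_of_action hg ha⟩

theorem Move.ne_root {γ γ' : Config N} {u : V} (h : γ.Move γ' u) : u ≠ N.root := by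
  rcases h with ⟨h | h, -⟩ | ⟨h, -⟩ | ⟨h, -⟩ | ⟨h, -⟩ <;> exact h.1

/-- A process of status `C` keeps status `C` without increasing its distance, or starts an error
broadcast. -/
theorem WeakStep.of_C {γ γ' : Config N} (h : γ.WeakStep γ') {v : V} (hv : γ.st v = Status.C) :
    (γ'.st v = Status.C ∨ γ'.st v = Status.EB) ∧ γ'.d v ≤ γ.d v := by
  rcases h v with (⟨hg, w, hw, -, hd, hs⟩ | ⟨hg, hs⟩ | ⟨hg, hs⟩ | ⟨hg, hs⟩) | hs
  · refine ⟨Or.inl hs, ?_⟩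
    rcases hg with hg | hg
    · obtain ⟨x, hx, hxC, hlt⟩ := hg.2.2
      exact hd ▸ (hw.2.2 x hx hxC).trans hlt.le
    · rcases hg.2.1 with h' | h'
      · cases hv.symm.trans h'.1
      · cases hv.symm.trans h'
  · exact ⟨Or.inr hs.1, hs.2.2.le⟩
  · cases hv.symm.trans hg.2.1
  · cases hv.symm.trans hg.2.1.1
  · exact ⟨Or.inl (hs.1.trans hv), hs.2.2.le⟩

/-- A process of status `EB` does not change, or all its children have status `EF` and it takes
status `EF`. -/
theorem WeakStep.of_EB {γ γ' : Config N} (h : γ.WeakStep γ') {v : V} (hv : γ.st v = Status.EB) :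
    γ'.par v = γ.par v ∧ γ'.d v = γ.d v ∧ (γ'.st v = Status.EB ∨
      γ'.st v = Status.EF ∧ ∀ w ∈ γ.children v, γ.st w = Status.EF) := by
  rcases h v with (⟨hg, -⟩ | ⟨hg, hs⟩ | ⟨hg, hs⟩ | ⟨hg, hs⟩) | hs
  · rcases hg with hg | hg
    · cases hv.symm.trans hg.2.1
    · rcases hg.2.1 with h' | h'
      · cases hv.symm.trans h'.1
      · cases hv.symm.trans h'
  · cases hv.symm.trans hg.2.1
  · exact ⟨hs.2.1, hs.2.2, Or.inr ⟨hs.1, hg.2.2⟩⟩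
  · cases hv.symm.trans hg.2.1.1
  · exact ⟨hs.2.1, hs.2.2, Or.inl (hs.1.trans hv)⟩

/-- A process of status `EF` that is not an abnormal root does not change. -/
theorem WeakStep.of_EF {γ γ' : Config N} (h : γ.WeakStep γ') {v : V} (hv : γ.st v = Status.EF)
    (ha : ¬ γ.AbRoot v) : γ.Same γ' v := by
  rcases h v with (⟨hg, -⟩ | ⟨hg, hs⟩ | ⟨hg, hs⟩ | ⟨hg, hs⟩) | hs
  · rcases hg with hg | hg
    · cases hv.symm.trans hg.2.1
    · rcases hg.2.1 with h' | h'
      · exact absurd h'.2 ha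
      · cases hv.symm.trans h'
  · cases hv.symm.trans hg.2.1
  · cases hv.symm.trans hg.2.1
  · exact absurd hg.2.1.2 ha
  · exact hs

/-- The macro `computePath` produces a process that is not an abnormal root. -/
theorem WeakStep.not_abRoot_of_computePath {γ γ' : Config N} (h : γ.WeakStep γ') {u : V}
    (hc : γ.ComputePath γ' u) : ¬ γ'.AbRoot u := by
  obtain ⟨v, hv, hp, hd, hs⟩ := hc
  obtain ⟨h1, h2⟩ := h.of_C hv.2.1
  refine not_abRoot_of_parent (v := v) ⟨hv.1, hp⟩ ?_ ?_ ?_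
  · rcases h1 with h1 | h1 <;> simp [h1]
  · rw [hd]; gcongr
  · rw [hs]; exact h1.imp Eq.symm id

/-! ### Persistence of alive abnormal roots and of frozen processes -/

/-- An alive abnormal root: a non-root abnormal root of status `C` or `EB`. -/
def AliveRoot (γ : Config N) (u : V) : Prop :=
  u ≠ N.root ∧ γ.AbRoot u ∧ γ.st u ≠ Status.EF

/-- No alive abnormal root is ever created. -/
theorem WeakStep.aliveRoot {γ γ' : Config N} (h : γ.WeakStep γ') {u : V}
    (hu : γ'.AliveRoot u) : γ.AliveRoot u := by
  obtain ⟨hr, hab, hEF⟩ := hu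
  by_contra hn
  -- While u is not `EF`, it is a child that blocks `R_EF` at its `EB` parent.
  have hstable : ∀ v, γ.PointsTo u v → γ.st u ≠ Status.EF → γ.d v + N.ω u v ≤ γ.d u →
      γ.st v = Status.EB → γ.st u ≠ Status.I → γ'.st v = Status.EB := by
    intro v hv hEF hd hs hI
    rcases (h.of_EB hs).2.2 with h1 | ⟨-, h1⟩
    · exact h1
    · refine absurd (h1 u ⟨hv.1.symm, by simp [hs], hI, hv, hd, Or.inr hs⟩) hEF
  -- Common to the moves that keep the parent and the distance of u: the old parent remains a
  -- consistent one.
  have hpar : ∀ (_ : γ.st u ≠ Status.EF) (_ : γ.st u ≠ Status.I) (_ : γ'.par u = γ.par u)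
      (_ : γ'.d u = γ.d u) (_ : γ'.st u = γ.st u ∨ γ'.st u = Status.EB ∧ γ.st u = Status.C ∧
        ∃ v, γ.PointsTo u v ∧ γ.st v = Status.EB), False := by
    intro hEF hI hp hd hst
    have hnab : ¬ γ.AbRoot u := fun h' => hn ⟨hr, h', hEF⟩
    obtain ⟨v, hv, hvI, hvd, hvs⟩ := exists_parent_of_not_abRoot hI hnab
    refine not_abRoot_of_parent (hv.congr hp) ?_ ?_ ?_ hab
    all_goals
      by_cases hvEB : γ.st v = Status.EB
      · simp [hstable v hv hEF hvd hvEB hI, hd, (h.of_EB hvEB).2.1, hvd]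
    all_goals
      have huv := hvs.resolve_right hvEB
      have hvC : γ.st v = Status.C := by
        cases hx : γ.st v <;> simp_all
      obtain ⟨h1, h2⟩ := h.of_C hvC
    · rcases h1 with h1 | h1 <;> simp [h1]
    · rw [hd]; exact le_trans (by gcongr) hvd
    · rcases hst with hst | ⟨-, -, w, hw, hwEB⟩
      · rw [hst, huv, hvC]; exact h1.imp Eq.symm id
      · obtain rfl := hv.unique hw
        exact absurd hwEB hvEB
  rcases h u with (⟨-, hc⟩ | ⟨hg, hs⟩ | ⟨hg, hs⟩ | ⟨hg, hs⟩) | hs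
  · exact h.not_abRoot_of_computePath hc hab
  · have hC := hg.2.1
    refine hpar (by simp [hC]) (by simp [hC]) hs.2.1 hs.2.2 (Or.inr ⟨hs.1, hC, ?_⟩)
    exact hg.2.2.2.resolve_left fun h' => hn ⟨hr, h', by simp [hC]⟩
  · exact hEF hs.1
  · exact hab.1 hs.1
  · exact hpar (hs.1 ▸ hEF) (hs.1 ▸ hab.1) hs.2.1 hs.2.2 (Or.inl hs.1)

/-- The processes of an error broadcast that is still controlled by an alive abnormal root. -/
inductive Frozen (γ : Config N) : V → Prop
  | root {u : V} : γ.AliveRoot u → γ.st u = Status.EB → Frozen γ u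
  | child {u v : V} : γ.PointsTo u v → Frozen γ v → (γ.st u = Status.EB ∨ γ.st u = Status.EF) →
      γ.d v + N.ω u v ≤ γ.d u → (γ.st u = γ.st v ∨ γ.st v = Status.EB) → Frozen γ u

theorem Frozen.st_eq {γ : Config N} {u : V} (h : γ.Frozen u) :
    γ.st u = Status.EB ∨ γ.st u = Status.EF := by
  cases h with
  | root _ h => exact Or.inl h
  | child _ _ h => exact h

/-- A frozen `EF` process has a consistent parent, so `R_I` and `R_R` are closed to it. -/
theorem Frozen.not_abRoot {γ : Config N} {u : V} (h : γ.Frozen u) (hu : γ.st u = Status.EF) :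
    ¬ γ.AbRoot u := by
  cases h with
  | root _ h => cases hu.symm.trans h
  | child hp hv _ hd hs =>
    exact not_abRoot_of_parent hp (by rcases hv.st_eq with h | h <;> simp [h]) hd hs

theorem ne_root_of_st_ne {γ : Config N} {u : V} (h : γ.st u ≠ Status.C) : u ≠ N.root := by
  rintro rfl
  exact h γ.st_root

theorem PointsTo.d_lt {γ : Config N} {u v : V} (h : γ.PointsTo u v)
    (hd : γ.d v + N.ω u v ≤ γ.d u) : γ.d v < γ.d u :=
  lt_of_lt_of_le (lt_add_of_pos_right _ (N.ω_pos h.1)) hd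

theorem wellFounded_d [Finite V] (γ : Config N) : WellFounded fun u v => γ.d u < γ.d v :=
  @Finite.wellFounded_of_trans_of_irrefl V _ _ ⟨fun _ _ _ h h' => lt_trans h h'⟩
    ⟨fun _ => lt_irrefl _⟩

/-- Parent pointers strictly decrease the distance, so in a finite network following them through
`EB` processes ends at an abnormal root. -/
theorem frozen_of_EB [Finite V] {γ : Config N} {u : V} (h : γ.st u = Status.EB) :
    γ.Frozen u := by
  induction u using γ.wellFounded_d.induction with
  | _ u ih =>
    by_cases ha : γ.AbRoot u
    · exact Frozen.root ⟨ne_root_of_st_ne (γ := γ) (by simp [h]), ha, by simp [h]⟩ h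
    · obtain ⟨v, hv, -, hd, hs⟩ := exists_parent_of_not_abRoot (by simp [h]) ha
      have hvs : γ.st v = Status.EB := hs.elim (fun h' => h' ▸ h) id
      exact Frozen.child hv (ih v (hv.d_lt hd) hvs) (Or.inl h) hd hs

/-- Frozen processes remain so as long as no alive abnormal root disappears. -/
theorem Frozen.step {γ γ' : Config N} {K : Set V} (h : γ.WeakStep γ')
    (hK : ∀ x y, N.graph.Adj x y → x ∈ K → y ∈ K)
    (hA : ∀ v ∈ K, γ.AliveRoot v → γ'.AliveRoot v) {u : V} (hu : γ.Frozen u) (huK : u ∈ K) :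
    γ'.Frozen u := by
  induction hu with
  | @root u ha hs =>
    have ha' := hA u huK ha
    exact Frozen.root ha' ((h.of_EB hs).2.2.resolve_right fun h' => ha'.2.2 h'.1)
  | @child u v hp hv hs hd hst ih =>
    have hv' := ih (hK _ _ hp.1 huK)
    have hnab : ¬ γ.AbRoot u :=
      not_abRoot_of_parent hp (by rcases hv.st_eq with h | h <;> simp [h]) hd hst
    have hu' : γ'.par u = γ.par u ∧ γ'.d u = γ.d u ∧
        (γ'.st u = Status.EB ∧ γ.st u = Status.EB ∨ γ'.st u = Status.EF) := by
      rcases hs with hs | hs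
      · have := h.of_EB hs
        tauto
      · have := h.of_EF hs hnab
        exact ⟨this.2.1, this.2.2, Or.inr (this.1.trans hs)⟩
    have hvd : γ'.d v = γ.d v := by
      rcases hv.st_eq with h1 | h1
      · exact (h.of_EB h1).2.1
      · exact (h.of_EF h1 (hv.not_abRoot h1)).2.2
    refine Frozen.child (hp.congr hu'.1) hv' ?_ (by rw [hu'.2.1, hvd]; exact hd) ?_
    · exact hu'.2.2.imp And.left id
    · rcases hv'.st_eq with h1 | h1
      · exact Or.inr h1
      · left
        rcases hu'.2.2 with ⟨h2, h3⟩ | h2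
        -- An `EB` process cannot have an `EF` parent here: if the parent has just become `EF`, its
        -- child u was already `EF`; if it was `EF` before, consistency forces u to be `EF`.
        · exfalso
          rcases hv.st_eq with h4 | h4
          · rcases (h.of_EB h4).2.2 with h5 | ⟨-, h5⟩
            · cases h1.symm.trans h5
            · cases h3.symm.trans (h5 u ⟨hp.1.symm, by simp [h4], by simp [h3], hp, hd, Or.inr h4⟩)
          · rcases hst with h5 | h5
            · cases h3.symm.trans (h5.trans h4)
            · cases h4.symm.trans h5
        · rw [h1, h2]

/-! ### Monotonicity of the phase -/

open Classical in
/-- The progress of `u` within a period in which the alive abnormal roots are constant. -/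
noncomputable def phase (γ : Config N) (u : V) : ℕ :=
  match γ.st u with
  | Status.I => 1
  | Status.C => 2
  | Status.EB => 3
  -- An unfrozen `EF` process may become resettable and opens the cycle; a frozen one closes it.
  | Status.EF => if γ.Frozen u then 4 else 0

theorem phase_I {γ : Config N} {u : V} (h : γ.st u = Status.I) : γ.phase u = 1 := by
  simp [phase, h]

theorem phase_C {γ : Config N} {u : V} (h : γ.st u = Status.C) : γ.phase u = 2 := by
  simp [phase, h]

theorem phase_EB {γ : Config N} {u : V} (h : γ.st u = Status.EB) : γ.phase u = 3 := by
  simp [phase, h]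

theorem phase_frozen {γ : Config N} {u : V} (h : γ.st u = Status.EF) (hf : γ.Frozen u) :
    γ.phase u = 4 := by
  simp [phase, h, hf]

theorem phase_of_abRoot {γ : Config N} {u : V} (h : γ.st u = Status.EF) (ha : γ.AbRoot u) :
    γ.phase u = 0 := by
  have : ¬ γ.Frozen u := fun hf => hf.not_abRoot h ha
  simp [phase, h, this]

theorem PathMove.phase_le {γ γ' : Config N} {u : V} (h : γ.PathMove γ' u) : γ.phase u ≤ 2 := by
  rcases h.1 with hg | hg
  · rw [phase_C hg.2.1]
  · rcases hg.2.1 with h' | h'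
    · rw [phase_of_abRoot h'.1 h'.2]; norm_num
    · rw [phase_I h']; norm_num

/-- Only `R_R`, from phases 0 and 1, can raise a distance. From phase 2 on a path move is `R_C`,
whose guard offers a smaller value. -/
theorem PathMove.d_lt {γ γ' : Config N} {u : V} (h : γ.PathMove γ' u) (hp : 2 ≤ γ.phase u) :
    γ'.d u < γ.d u := by
  obtain ⟨hg, w, hw, -, hd, hs⟩ := h
  rcases hg with hg | hg
  · obtain ⟨x, hx, hxC, hlt⟩ := hg.2.2
    exact hd ▸ (hw.2.2 x hx hxC).trans_lt hlt
  · rcases hg.2.1 with h' | h'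
    · rw [phase_of_abRoot h'.1 h'.2] at hp; omega
    · rw [phase_I h'] at hp; omega

theorem StatusMove.d_eq {γ γ' : Config N} {u : V} (h : γ.StatusMove γ' u) : γ'.d u = γ.d u := by
  rcases h with ⟨-, h⟩ | ⟨-, h⟩ | ⟨-, h⟩ <;> exact h.2.2

theorem WeakStep.d_le {γ γ' : Config N} (h : γ.WeakStep γ') {u : V} (hp : 2 ≤ γ.phase u) :
    γ'.d u ≤ γ.d u := by
  rcases h u with (h | h) | h
  · exact (h.d_lt hp).le
  · exact h.d_eq.le
  · exact h.2.2.le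

theorem StatusMove.phase_mem {γ γ' : Config N} {u : V} (h : γ.StatusMove γ' u) :
    γ.phase u ∈ ({0, 2, 3} : Finset ℕ) := by
  rcases h with ⟨hg, -⟩ | ⟨hg, -⟩ | ⟨hg, -⟩
  · simp [phase_C hg.2.1]
  · simp [phase_EB hg.2.1]
  · simp [phase_of_abRoot hg.2.1.1 hg.2.1.2]

/-- The critical case is `R_EF`: an `EB` process is frozen and remains so, hence it lands in phase 4
and not in phase 0. -/
theorem StatusMove.phase_lt [Finite V] {γ γ' : Config N} {K : Set V} (h : γ.WeakStep γ')
    (hK : ∀ x y, N.graph.Adj x y → x ∈ K → y ∈ K)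
    (hA : ∀ v ∈ K, γ.AliveRoot v → γ'.AliveRoot v) {u : V} (huK : u ∈ K)
    (hm : γ.StatusMove γ' u) : γ.phase u < γ'.phase u := by
  rcases hm with ⟨hg, hs⟩ | ⟨hg, hs⟩ | ⟨hg, hs⟩
  · rw [phase_C hg.2.1, phase_EB hs.1]; norm_num
  · rw [phase_EB hg.2.1, phase_frozen hs.1 ((frozen_of_EB hg.2.1).step h hK hA huK)]; norm_num
  · rw [phase_of_abRoot hg.2.1.1 hg.2.1.2, phase_I hs.1]; norm_num

theorem WeakStep.phase_le [Finite V] {γ γ' : Config N} {K : Set V} (h : γ.WeakStep γ')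
    (hK : ∀ x y, N.graph.Adj x y → x ∈ K → y ∈ K)
    (hA : ∀ v ∈ K, γ.AliveRoot v → γ'.AliveRoot v) {u : V} (huK : u ∈ K) :
    γ.phase u ≤ γ'.phase u := by
  rcases h u with (hm | hm) | hm
  · obtain ⟨v, hv⟩ := hm.2
    rw [phase_C hv.2.2.2]
    exact hm.phase_le
  · exact (hm.phase_lt h hK hA huK).le
  · cases hs : γ.st u
    · rw [phase_I hs, phase_I (hm.1.trans hs)]
    · rw [phase_C hs, phase_C (hm.1.trans hs)]
    · rw [phase_EB hs, phase_EB (hm.1.trans hs)]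
    · by_cases hf : γ.Frozen u
      · rw [phase_frozen hs hf, phase_frozen (hm.1.trans hs) (hf.step h hK hA huK)]
      · simp [phase, hs, hf]

end Config

/-! ### Moves of a process within one segment -/

open Config

/-- A period `i, …, j` of a sequence of configurations during which, except possibly in the last
step, no alive abnormal root of the union of components `K` disappears. -/
structure Segment (c : ℕ → Config N) (K : Set V) (i j : ℕ) : Prop where
  closed : ∀ x y, N.graph.Adj x y → x ∈ K → y ∈ K
  step : ∀ k, i ≤ k → k < j → (c k).WeakStep (c (k + 1))
  steady : ∀ k, i ≤ k → k + 1 < j → ∀ v ∈ K, (c k).AliveRoot v → (c (k + 1)).AliveRoot v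

open Classical in
/-- The number of steps between times `i` and `j` in which `u` moves. -/
noncomputable def moveCount (c : ℕ → Config N) (u : V) (i j : ℕ) : ℕ :=
  ((Finset.Ico i j).filter fun k => (c k).Move (c (k + 1)) u).card

theorem moveCount_eq_zero (c : ℕ → Config N) (u : V) {i j : ℕ} (h : j ≤ i) :
    moveCount c u i j = 0 := by
  simp [moveCount, Finset.Ico_eq_empty_of_le h]

theorem moveCount_le_add (c : ℕ → Config N) (u : V) (i k j : ℕ) :
    moveCount c u i j ≤ moveCount c u i k + moveCount c u k j := by
  classical
  refine (Finset.card_le_card ?_).trans (Finset.card_union_le _ _)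
  intro l hl
  simp only [Finset.mem_filter, Finset.mem_union, Finset.mem_Ico] at hl ⊢
  have := lt_or_ge l k
  tauto

namespace Segment

variable {c : ℕ → Config N} {K : Set V} {i j : ℕ} {u : V}

/-- The inequality `l < j` is strict because the last step may remove an alive root and unfreeze u.
-/
theorem phase_mono [Finite V] (h : Segment c K i j) (hu : u ∈ K) {k l : ℕ} (hik : i ≤ k)
    (hkl : k ≤ l) (hl : l < j) : (c k).phase u ≤ (c l).phase u := by
  induction l, hkl using Nat.le_induction with
  | base => exact le_rfl
  | succ l hkl ih =>
    exact (ih (by omega)).trans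
      ((h.step l (by omega) (by omega)).phase_le h.closed (h.steady l (by omega) hl) hu)

/-- Here `l = j` is allowed: the last step changes the distance according to the phase before it. -/
theorem d_anti [Finite V] (h : Segment c K i j) (hu : u ∈ K) {k l : ℕ} (hik : i ≤ k)
    (hkl : k ≤ l) (hl : l ≤ j) (hp : 2 ≤ (c k).phase u) : (c l).d u ≤ (c k).d u := by
  induction l, hkl using Nat.le_induction with
  | base => exact le_rfl
  | succ l hkl ih =>
    exact ((h.step l (by omega) (by omega)).d_le
      (hp.trans (h.phase_mono hu hik hkl (by omega)))).trans (ih (by omega))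

theorem aliveRoot (h : Segment c K i j) (hu : u ∈ K) (ha : (c i).AliveRoot u) {k : ℕ}
    (hik : i ≤ k) (hk : k < j) : (c k).AliveRoot u := by
  induction k, hik using Nat.le_induction with
  | base => exact ha
  | succ k hik ih => exact h.steady k hik hk u hu (ih (by omega))

theorem phase_lt_of_statusMove [Finite V] (h : Segment c K i j) (hu : u ∈ K) {k l : ℕ}
    (hik : i ≤ k) (hkl : k < l) (hl : l < j) (hm : (c k).StatusMove (c (k + 1)) u) :
    (c k).phase u < (c l).phase u :=
  (hm.phase_lt (h.step k hik (by omega)) h.closed (h.steady k hik (by omega)) hu).trans_le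
    (h.phase_mono hu (by omega) hkl hl)

open Classical in
-- Status moves start in phases 0 (`R_I`), 2 (`R_EB`) or 3 (`R_EF`), and each strictly raises the
-- phase.
theorem card_statusMove_le [Finite V] (h : Segment c K i j) (hu : u ∈ K) :
    ((Finset.Ico i j).filter fun k => (c k).StatusMove (c (k + 1)) u).card ≤ 3 := by
  refine (Finset.card_le_card_of_injOn (t := {0, 2, 3}) (fun k => (c k).phase u) ?_ ?_).trans
    (by decide)
  · intro k hk
    exact (Finset.mem_filter.1 hk).2.phase_mem
  · intro k hk l hl hkl
    simp only [Finset.coe_filter, Set.mem_ofPred_eq, Finset.mem_Ico] at hk hl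
    rcases lt_trichotomy k l with hlt | rfl | hlt
    · exact absurd hkl (h.phase_lt_of_statusMove hu hk.1.1 hlt hl.1.2 hk.2).ne
    · rfl
    · exact absurd hkl (h.phase_lt_of_statusMove hu hl.1.1 hlt hk.1.2 hl.2).ne'

/-- A process that is an alive abnormal root moves at most twice during the segment. -/
theorem moveCount_le_two [Finite V] (h : Segment c K i j) (hu : u ∈ K)
    (ha : (c i).AliveRoot u) : moveCount c u i j ≤ 2 := by
  classical
  -- Before the last step u must remain an alive root, which leaves only `R_EB`, available once. The
  -- last step is unconstrained and accounts for the second move.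
  have key : ∀ k, i ≤ k → k + 1 < j → (c k).Move (c (k + 1)) u →
      (c k).StatusMove (c (k + 1)) u ∧ (c k).phase u = 2 := by
    intro k hik hk hm
    have h1 := h.aliveRoot hu ha hik (by omega)
    have h2 := h.aliveRoot hu ha (show i ≤ k + 1 by omega) hk
    rcases hm with hm | hm
    · exact absurd h2.2.1 ((h.step k hik (by omega)).not_abRoot_of_computePath hm.2)
    · refine ⟨hm, ?_⟩
      rcases hm with ⟨hg, -⟩ | ⟨-, hs⟩ | ⟨-, hs⟩
      · exact phase_C hg.2.1
      · exact absurd hs.1 h2.2.2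
      · exact absurd hs.1 h2.2.1.1
  have hsub : ((Finset.Ico i j).filter fun k => (c k).Move (c (k + 1)) u) ⊆
      insert (j - 1) ((Finset.Ico i (j - 1)).filter fun k => (c k).Move (c (k + 1)) u) := by
    intro k hk
    simp only [Finset.mem_filter, Finset.mem_insert, Finset.mem_Ico] at hk ⊢
    by_cases hkj : k = j - 1
    · exact Or.inl hkj
    · exact Or.inr ⟨⟨hk.1.1, by omega⟩, hk.2⟩
  refine (Finset.card_le_card hsub).trans ((Finset.card_insert_le _ _).trans ?_)
  refine Nat.succ_le_succ (Finset.card_le_one.2 ?_)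
  intro k hk l hl
  simp only [Finset.mem_filter, Finset.mem_Ico] at hk hl
  obtain ⟨hk1, hk2⟩ := key k hk.1.1 (by omega) hk.2
  obtain ⟨hl1, hl2⟩ := key l hl.1.1 (by omega) hl.2
  rcases lt_trichotomy k l with hlt | rfl | hlt
  · have := h.phase_lt_of_statusMove hu hk.1.1 hlt (by omega) hk1
    omega
  · rfl
  · have := h.phase_lt_of_statusMove hu hl.1.1 hlt (by omega) hl1
    omega

/-- The distance of a process of status `C` comes from the initial distance of a process `s`,
along a set `S` of distinct processes. -/
theorem exists_origin [Finite V] (h : Segment c K i j) {w : ℝ≥0}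
    (hw : ∀ x y, N.graph.Adj x y → N.ω x y = w) {k : ℕ} (hik : i ≤ k) (hk : k < j) {v : V}
    (hv : v ∈ K) (hC : (c k).st v = Status.C) :
    ∃ S : Finset V, ∃ s ∈ S, (∀ x ∈ S, x ∈ K) ∧ (N.root ∈ S → s = N.root) ∧
      (c k).d v + w = (c i).d s + S.card * w ∧
      ∀ x ∈ S, ∃ l, i ≤ l ∧ l ≤ k ∧ (c l).st x = Status.C ∧ (c l).d x ≤ (c k).d v := by
  classical
  induction k, hik using Nat.le_induction generalizing v with
  | base =>
    refine ⟨{v}, v, by simp, by simpa using hv, by simp [eq_comm], by simp, ?_⟩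
    intro x hx
    obtain rfl := Finset.mem_singleton.1 hx
    exact ⟨i, le_rfl, le_rfl, hC, le_rfl⟩
  | succ k hik ih =>
    have hstep := h.step k hik (by omega)
    rcases hstep v with (hm | hm) | hm
    · obtain ⟨y, hy, -, hd, hs⟩ := hm.2
      obtain ⟨S, s, hsS, hSK, hroot, hdS, hl⟩ :=
        ih (by omega) (h.closed _ _ hy.1 hv) hy.2.1
      have hwpos : 0 < w := hw _ _ hy.1 ▸ N.ω_pos hy.1
      rw [hw _ _ hy.1] at hd
      -- Otherwise v already had status `C` with distance at most that of y; it could not have grown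
      -- to d_y + w since.
      have hvS : v ∉ S := by
        intro hvS
        obtain ⟨l, hil, hlk, hlC, hld⟩ := hl v hvS
        have := h.d_anti hv hil (show l ≤ k + 1 by omega) (by omega) (phase_C hlC).ge
        rw [hd] at this
        exact absurd (this.trans hld) (not_le.2 (lt_add_of_pos_right _ hwpos))
      -- The root never moves, so it can enter S only as the origin.
      have hvr : v ≠ N.root := Move.ne_root (Or.inl hm)
      refine ⟨insert v S, s, by simp [hsS], ?_, ?_, ?_, ?_⟩
      · simpa [hv] using hSK
      · intro hr
        exact hroot ((Finset.mem_insert.1 hr).resolve_left hvr.symm)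
      · rw [hd, hdS, Finset.card_insert_of_notMem hvS]
        push_cast
        ring
      · intro x hx
        rcases Finset.mem_insert.1 hx with rfl | hx
        · exact ⟨k + 1, by omega, le_rfl, hC, le_rfl⟩
        · obtain ⟨l, hil, hlk, hlC, hld⟩ := hl x hx
          exact ⟨l, hil, by omega, hlC, hld.trans (hd ▸ le_self_add)⟩
    · rcases hm with ⟨-, hm⟩ | ⟨-, hm⟩ | ⟨-, hm⟩ <;> cases hC.symm.trans hm.1
    · obtain ⟨S, s, hsS, hSK, hroot, hdS, hl⟩ := ih (by omega) hv (hm.1 ▸ hC)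
      refine ⟨S, s, hsS, hSK, hroot, by rw [hm.2.2, hdS], ?_⟩
      intro x hx
      obtain ⟨l, hil, hlk, hlC, hld⟩ := hl x hx
      exact ⟨l, hil, by omega, hlC, by rw [hm.2.2]; exact hld⟩

/-- The origin of the distance computed by a process `u` does not involve `u`. -/
theorem exists_origin_of_pathMove [Finite V] (h : Segment c K i j) {w : ℝ≥0}
    (hw : ∀ x y, N.graph.Adj x y → N.ω x y = w) {k : ℕ} (hik : i ≤ k) (hk : k < j)
    (hu : u ∈ K) (hm : (c k).PathMove (c (k + 1)) u) :
    ∃ S : Finset V, ∃ s ∈ S, u ∉ S ∧ (∀ x ∈ S, x ∈ K) ∧ (N.root ∈ S → s = N.root) ∧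
      (c (k + 1)).d u = (c i).d s + S.card * w := by
  obtain ⟨y, hy, -, hd, hs⟩ := hm.2
  obtain ⟨S, s, hsS, hSK, hroot, hdS, hl⟩ :=
    h.exists_origin hw hik hk (h.closed _ _ hy.1 hu) hy.2.1
  have hwpos : 0 < w := hw _ _ hy.1 ▸ N.ω_pos hy.1
  rw [hw _ _ hy.1] at hd
  refine ⟨S, s, hsS, ?_, hSK, hroot, hd.trans hdS⟩
  intro huS
  obtain ⟨l, hil, hlk, hlC, hld⟩ := hl u huS
  have := h.d_anti hu hil (show l ≤ k + 1 by omega) (by omega) (phase_C hlC).ge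
  rw [hd] at this
  exact absurd (this.trans hld) (not_le.2 (lt_add_of_pos_right _ hwpos))

theorem d_lt_of_pathMove [Finite V] (h : Segment c K i j) (hu : u ∈ K) {k l : ℕ}
    (hik : i ≤ k) (hkl : k < l) (hl : l < j) (hk : (c k).PathMove (c (k + 1)) u)
    (hlm : (c l).PathMove (c (l + 1)) u) : (c (l + 1)).d u < (c (k + 1)).d u := by
  obtain ⟨y, -, -, -, hs⟩ := hk.2
  have hp : 2 ≤ (c (k + 1)).phase u := (phase_C hs).ge
  exact (hlm.d_lt (hp.trans (h.phase_mono hu (by omega) hkl hl))).trans_le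
    (h.d_anti hu (by omega) hkl (by omega) hp)

open Classical in
-- Successive path moves strictly decrease the distance, so it suffices to count the values that can
-- be written.
theorem card_pathMove_le [Finite V] (h : Segment c K i j) {w : ℝ≥0}
    (hw : ∀ x y, N.graph.Adj x y → N.ω x y = w) (hu : u ∈ K) (hur : u ≠ N.root) {m : ℕ}
    (hm : (K \ {N.root}).ncard ≤ m) :
    ((Finset.Ico i j).filter fun k => (c k).PathMove (c (k + 1)) u).card ≤
      m + (m - 1) * (m - 1) := by
  set R : Finset V := (Set.toFinite (K \ {N.root})).toFinset with hR
  have hRm : (R.erase u).card ≤ m - 1 := by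
    rw [Finset.card_erase_of_mem (by simp [hR, hu, hur])]
    rw [Set.ncard_eq_toFinset_card _ (Set.toFinite _)] at hm
    exact Nat.sub_le_sub_right hm 1
  have hm1 : 1 ≤ m := by
    refine le_trans ?_ hm
    exact (Set.ncard_pos (Set.toFinite _)).2 ⟨u, hu, hur⟩
  -- Origin at the root: S has at most the root and m-1 others. Otherwise both s and S avoid the
  -- root and u, leaving m-1 origins and m-1 cardinalities.
  set F : Finset ℝ≥0 :=
    (Finset.Icc 1 m).image (fun t : ℕ => (c i).d N.root + t * w) ∪
      ((R.erase u) ×ˢ Finset.Icc 1 (m - 1)).image (fun p : V × ℕ => (c i).d p.1 + p.2 * w) with hF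
  have hFc : F.card ≤ m + (m - 1) * (m - 1) := by
    refine (Finset.card_union_le _ _).trans (add_le_add ?_ ?_)
    · exact Finset.card_image_le.trans (by simp)
    · refine Finset.card_image_le.trans ?_
      rw [Finset.card_product]
      exact Nat.mul_le_mul hRm (by simp)
  refine (Finset.card_le_card_of_injOn (t := F) (fun k => (c (k + 1)).d u) ?_ ?_).trans hFc
  · intro k hk
    simp only [Finset.coe_filter, Set.mem_ofPred_eq, Finset.mem_Ico] at hk
    obtain ⟨S, s, hsS, huS, hSK, hroot, hd⟩ :=
      h.exists_origin_of_pathMove hw hk.1.1 hk.1.2 hu hk.2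
    have hS1 : 1 ≤ S.card := Finset.card_pos.2 ⟨s, hsS⟩
    have hSR : ∀ x ∈ S, x ≠ N.root → x ∈ R.erase u := by
      intro x hx hxr
      simp only [hR, Finset.mem_erase, Set.Finite.mem_toFinset, Set.mem_sdiff,
        Set.mem_singleton_iff]
      exact ⟨fun hxu => huS (hxu ▸ hx), hSK x hx, hxr⟩
    simp only [hF, Finset.coe_union, Set.mem_union, Finset.mem_coe, Finset.mem_image,
      Finset.mem_Icc, Finset.mem_product, Prod.exists]
    by_cases hr : N.root ∈ S
    · left
      refine ⟨S.card, ⟨hS1, ?_⟩, by rw [hd, hroot hr]⟩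
      have : S ⊆ insert N.root (R.erase u) := by
        intro x hx
        by_cases hxr : x = N.root
        · simp [hxr]
        · exact Finset.mem_insert_of_mem (hSR x hx hxr)
      have := (Finset.card_le_card this).trans (Finset.card_insert_le _ _)
      omega
    · right
      have hne : ∀ x ∈ S, x ≠ N.root := fun x hx hxr => hr (hxr ▸ hx)
      refine ⟨s, S.card, ⟨hSR s hsS (hne s hsS), hS1, ?_⟩, hd.symm⟩
      exact (Finset.card_le_card fun x hx => hSR x hx (hne x hx)).trans hRm
  · intro k hk l hl hkl
    simp only [Finset.coe_filter, Set.mem_ofPred_eq, Finset.mem_Ico] at hk hl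
    rcases lt_trichotomy k l with hlt | rfl | hlt
    · exact absurd hkl (h.d_lt_of_pathMove hu hk.1.1 hlt hl.1.2 hk.2 hl.2).ne'
    · rfl
    · exact absurd hkl (h.d_lt_of_pathMove hu hl.1.1 hlt hk.1.2 hl.2 hk.2).ne

theorem moveCount_le [Finite V] (h : Segment c K i j) {w : ℝ≥0}
    (hw : ∀ x y, N.graph.Adj x y → N.ω x y = w) (hu : u ∈ K) (hur : u ≠ N.root) {m : ℕ}
    (hm : (K \ {N.root}).ncard ≤ m) : moveCount c u i j ≤ m + (m - 1) * (m - 1) + 3 := by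
  classical
  refine le_trans ?_ (add_le_add (h.card_pathMove_le hw hu hur hm) (h.card_statusMove_le hu))
  refine (Finset.card_le_card ?_).trans (Finset.card_union_le _ _)
  intro k hk
  rw [Finset.mem_filter] at hk
  rw [Finset.mem_union, Finset.mem_filter, Finset.mem_filter, ← and_or_left]
  exact hk

end Segment

/-! ### Summation over the segments -/

/-- The alive abnormal roots in `K`. -/
def Config.aliveRoots (γ : Config N) (K : Set V) : Set V := {v | v ∈ K ∧ γ.AliveRoot v}

section count

variable {c : ℕ → Config N} {K : Set V} {j : ℕ}

theorem aliveRoots_anti (hstep : ∀ k < j, (c k).WeakStep (c (k + 1))) {k l : ℕ} (hkl : k ≤ l)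
    (hl : l ≤ j) : (c l).aliveRoots K ⊆ (c k).aliveRoots K := by
  induction l, hkl using Nat.le_induction with
  | base => exact subset_rfl
  | succ l hkl ih =>
    exact fun v hv => ih (by omega) ⟨hv.1, (hstep l (by omega)).aliveRoot hv.2⟩

/-- The first segment that starts at time `i`. -/
theorem exists_segment (hstep : ∀ k < j, (c k).WeakStep (c (k + 1)))
    (hK : ∀ x y, N.graph.Adj x y → x ∈ K → y ∈ K) (i : ℕ) :
    ∃ k, Segment c K i k ∧ (j ≤ k ∨ (c k).aliveRoots K ⊂ (c i).aliveRoots K) := by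
  classical
  -- The segment ends at the first time that reaches j or sees a different set of alive roots; as
  -- this set only shrinks, the difference is a loss.
  have hex : ∃ k, i ≤ k ∧ (j ≤ k ∨ (c k).aliveRoots K ≠ (c i).aliveRoots K) :=
    ⟨max i j, le_max_left _ _, Or.inl (le_max_right _ _)⟩
  have hmin : ∀ l, i ≤ l → l < Nat.find hex →
      l < j ∧ (c l).aliveRoots K = (c i).aliveRoots K := by
    intro l hil hl
    have := Nat.find_min hex hl
    push Not at this
    exact this hil
  refine ⟨Nat.find hex, ⟨hK, fun k hik hk => hstep k (hmin k hik hk).1, ?_⟩, ?_⟩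
  · intro k hik hk v hv ha
    have h1 : v ∈ (c k).aliveRoots K := ⟨hv, ha⟩
    rw [(hmin k hik (by omega)).2, ← (hmin (k + 1) (by omega) hk).2] at h1
    exact h1.2
  · obtain ⟨h1, h2⟩ := Nat.find_spec hex
    by_cases hj : j ≤ Nat.find hex
    · exact Or.inl hj
    · refine Or.inr ((aliveRoots_anti hstep h1 (by omega)).ssubset_of_ne ?_)
      exact h2.resolve_left hj

variable [Finite V] {w : ℝ≥0} {u : V} {m : ℕ}

/-- Each segment that ends before j uses up an alive root, so a roots allow a+1 segments. -/
theorem moveCount_le_of_ncard (hstep : ∀ k < j, (c k).WeakStep (c (k + 1)))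
    (hK : ∀ x y, N.graph.Adj x y → x ∈ K → y ∈ K)
    (hw : ∀ x y, N.graph.Adj x y → N.ω x y = w) (hu : u ∈ K) (hur : u ≠ N.root)
    (hm : (K \ {N.root}).ncard ≤ m) (a i : ℕ) (ha : ((c i).aliveRoots K).ncard ≤ a) :
    moveCount c u i j ≤ (a + 1) * (m + (m - 1) * (m - 1) + 3) := by
  induction a generalizing i with
  | zero =>
    obtain ⟨k, hs, hk | hk⟩ := exists_segment hstep hK i
    · have := moveCount_le_add c u i k j
      have := moveCount_eq_zero c u hk
      have := hs.moveCount_le hw hu hur hm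
      omega
    · have := Set.ncard_lt_ncard hk (Set.toFinite _)
      omega
  | succ a ih =>
    obtain ⟨k, hs, hk⟩ := exists_segment hstep hK i
    have h1 := moveCount_le_add c u i k j
    have h2 := hs.moveCount_le hw hu hur hm
    have h3 : moveCount c u k j ≤ (a + 1) * (m + (m - 1) * (m - 1) + 3) := by
      rcases hk with hk | hk
      · simp [moveCount_eq_zero c u hk]
      · have := Set.ncard_lt_ncard hk (Set.toFinite _)
        exact ih k (by omega)
    rw [add_mul (a + 1), one_mul]
    omega

/-- The cheap first segment compensates for u itself being counted among the alive roots. -/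
theorem moveCount_le_of_aliveRoot (hstep : ∀ k < j, (c k).WeakStep (c (k + 1)))
    (hK : ∀ x y, N.graph.Adj x y → x ∈ K → y ∈ K)
    (hw : ∀ x y, N.graph.Adj x y → N.ω x y = w) (hu : u ∈ K) (hur : u ≠ N.root)
    (hm : (K \ {N.root}).ncard ≤ m) {i : ℕ} (hi : (c i).AliveRoot u) :
    moveCount c u i j ≤ 2 + ((c i).aliveRoots K).ncard * (m + (m - 1) * (m - 1) + 3) := by
  obtain ⟨k, hs, hk⟩ := exists_segment hstep hK i
  refine (moveCount_le_add c u i k j).trans (add_le_add (hs.moveCount_le_two hu hi) ?_)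
  rcases hk with hk | hk
  · simp [moveCount_eq_zero c u hk]
  · have := Set.ncard_lt_ncard hk (Set.toFinite _)
    refine (moveCount_le_of_ncard hstep hK hw hu hur hm
      (((c i).aliveRoots K).ncard - 1) k (by omega)).trans (Nat.mul_le_mul_right _ (by omega))

/-- The number of moves of a process. -/
theorem moveCount_le_cube (hstep : ∀ k < j, (c k).WeakStep (c (k + 1)))
    (hK : ∀ x y, N.graph.Adj x y → x ∈ K → y ∈ K)
    (hw : ∀ x y, N.graph.Adj x y → N.ω x y = w) (hu : u ∈ K) (hur : u ≠ N.root)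
    (hm : (K \ {N.root}).ncard ≤ m) : moveCount c u 0 j ≤ m ^ 3 + 2 * m + 3 := by
  have hm1 : 1 ≤ m := by
    refine le_trans ?_ hm
    exact (Set.ncard_pos (Set.toFinite _)).2 ⟨u, hu, hur⟩
  have hsub : (c 0).aliveRoots K ⊆ K \ {N.root} := fun v hv => ⟨hv.1, hv.2.1⟩
  have hle := (Set.ncard_le_ncard hsub (Set.toFinite _)).trans hm
  -- The right side exceeds the left by exactly (m-1)^2.
  have harith : 2 + m * (m + (m - 1) * (m - 1) + 3) ≤ m ^ 3 + 2 * m + 3 := by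
    obtain ⟨p, rfl⟩ := Nat.exists_eq_add_of_le' hm1
    simp only [Nat.add_sub_cancel]
    nlinarith
  by_cases hu0 : (c 0).AliveRoot u
  · exact (moveCount_le_of_aliveRoot hstep hK hw hu hur hm hu0).trans
      (le_trans (by gcongr) harith)
  · have hlt : ((c 0).aliveRoots K).ncard < (K \ {N.root}).ncard :=
      Set.ncard_lt_ncard (hsub.ssubset_of_mem_notMem (show u ∈ K \ {N.root} from ⟨hu, hur⟩)
        fun h => hu0 h.2) (Set.toFinite _)
    have := moveCount_le_of_ncard hstep hK hw hu hur hm (m - 1) 0 (by omega)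
    rw [Nat.sub_add_cancel hm1] at this
    omega

end count

/-! ### Terminal configurations are legitimate -/

namespace Config

theorem Terminal.not_guard {γ : Config N} (h : γ.Terminal) (u : V) (ρ : Rule) :
    ¬ γ.Guard u ρ := fun hg => h u ⟨ρ, hg⟩

theorem Terminal.not_abRoot_of_C {γ : Config N} (h : γ.Terminal) {u : V} (hu : u ≠ N.root)
    (hC : γ.st u = Status.C) : ¬ γ.PCorrection u ∧ ¬ γ.AbRoot u ∧
      ¬ ∃ v, γ.PointsTo u v ∧ γ.st v = Status.EB := by
  have h1 : ¬ γ.PCorrection u := fun hp => h.not_guard u Rule.RC ⟨hu, hC, hp⟩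
  have h2 := h.not_guard u Rule.REB
  simp only [Guard, not_and] at h2
  exact ⟨h1, not_or.1 (h2 hu hC h1)⟩

/-- Take an `EB` process of maximal distance: its children are farther, hence not `EB`, and a `C`
child would be enabled. All are `EF`, so `R_EF` is enabled. -/
theorem Terminal.st_ne_EB [Finite V] {γ : Config N} (h : γ.Terminal) (u : V) :
    γ.st u ≠ Status.EB := by
  intro hu
  obtain ⟨v, hv, hmax⟩ := Set.exists_max_image {v | γ.st v = Status.EB} γ.d (Set.toFinite _)
    ⟨u, hu⟩
  refine h.not_guard v Rule.REF ⟨ne_root_of_st_ne (γ := γ) (by simp [hv.out]), hv, ?_⟩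
  rintro w ⟨-, -, hI, hp, hd, -⟩
  cases hw : γ.st w
  · exact absurd hw hI
  · have hwr : w ≠ N.root := by
      rintro rfl
      have := (γ.par_eq_none_iff N.root).2 rfl
      cases this.symm.trans hp.2
    exact absurd ⟨v, hp, hv⟩ (h.not_abRoot_of_C hwr hw).2.2
  · exact absurd (hmax w hw) (not_le.2 (hp.d_lt hd))
  · rfl

/-- An abnormal `EF` root is enabled by `R_I` or `R_R`; otherwise its parent is `EB`, or `EF` at
smaller distance. -/
theorem Terminal.st_ne_EF [Finite V] {γ : Config N} (h : γ.Terminal) (u : V) :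
    γ.st u ≠ Status.EF := by
  induction u using γ.wellFounded_d.induction with
  | _ u ih =>
    intro hu
    have hr : u ≠ N.root := ne_root_of_st_ne (γ := γ) (by simp [hu])
    by_cases ha : γ.AbRoot u
    · by_cases hC : ∃ v, N.graph.Adj u v ∧ γ.st v = Status.C
      · exact h.not_guard u Rule.RR ⟨hr, Or.inl ⟨hu, ha⟩, hC⟩
      · push Not at hC
        exact h.not_guard u Rule.RI ⟨hr, ⟨hu, ha⟩, hC⟩
    · obtain ⟨v, hv, -, hd, hs⟩ := exists_parent_of_not_abRoot (by simp [hu]) ha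
      rcases hs with hs | hs
      · exact ih v (hv.d_lt hd) (hs ▸ hu)
      · exact h.st_ne_EB v hs

theorem Terminal.exists_parent [Finite V] {γ : Config N} (h : γ.Terminal) {u : V}
    (hu : u ≠ N.root) (hC : γ.st u = Status.C) :
    ∃ v, γ.PointsTo u v ∧ γ.st v = Status.C ∧ γ.d u = γ.d v + N.ω u v := by
  obtain ⟨h1, h2, -⟩ := h.not_abRoot_of_C hu hC
  obtain ⟨v, hv, -, hd, hs⟩ := exists_parent_of_not_abRoot (by simp [hC]) h2
  have hvC : γ.st v = Status.C := (hs.resolve_right (h.st_ne_EB v)).symm.trans hC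
  refine ⟨v, hv, hvC, le_antisymm ?_ hd⟩
  by_contra hlt
  exact h1 ⟨v, hv.1, hvC, not_le.1 hlt⟩

/-- In a terminal configuration, the distance of a process of status `C` is the weight of some
path to the root. -/
theorem Terminal.exists_walk [Finite V] {γ : Config N} (h : γ.Terminal) {u : V}
    (hC : γ.st u = Status.C) : ∃ p : N.graph.Walk u N.root, N.pathWeight p = γ.d u := by
  induction u using γ.wellFounded_d.induction with
  | _ u ih =>
    by_cases hu : u = N.root
    · subst hu
      exact ⟨SimpleGraph.Walk.nil, by simp [Network.pathWeight, γ.d_root]⟩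
    · obtain ⟨v, hv, hvC, hd⟩ := h.exists_parent hu hC
      obtain ⟨p, hp⟩ := ih v (hv.d_lt hd.ge) hvC
      refine ⟨SimpleGraph.Walk.cons hv.1 p, ?_⟩
      rw [hd, ← hp, Network.pathWeight, Network.pathWeight, SimpleGraph.Walk.edges_cons,
        List.map_cons, List.sum_cons, add_comm]
      rfl

/-- In a terminal configuration, a process connected to the root has status `C`, and its distance
is at most the weight of any path. -/
theorem Terminal.d_le_pathWeight [Finite V] {γ : Config N} (h : γ.Terminal) {u v : V}
    (p : N.graph.Walk u v) (hv : γ.st v = Status.C) :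
    γ.st u = Status.C ∧ γ.d u ≤ N.pathWeight p + γ.d v := by
  induction p with
  | nil => exact ⟨hv, by simp [Network.pathWeight]⟩
  | @cons u x v hux p ih =>
    obtain ⟨hx, hd⟩ := ih hv
    have huC : γ.st u = Status.C := by
      cases hs : γ.st u
      · exact absurd ⟨ne_root_of_st_ne (γ := γ) (by simp [hs]), Or.inr hs, x, hux, hx⟩
          (h.not_guard u Rule.RR)
      · rfl
      · exact absurd hs (h.st_ne_EB u)
      · exact absurd hs (h.st_ne_EF u)
    refine ⟨huC, ?_⟩
    have h1 : γ.d u ≤ γ.d x + N.ω u x := by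
      by_cases hu : u = N.root
      · rw [hu, γ.d_root]; exact zero_le
      · by_contra hlt
        exact (h.not_abRoot_of_C hu huC).1 ⟨x, hux, hx, not_le.1 hlt⟩
    have h2 : N.pathWeight (SimpleGraph.Walk.cons hux p) = N.ω u x + N.pathWeight p := by
      simp [Network.pathWeight, Network.ω]
    rw [h2]
    calc γ.d u ≤ γ.d x + N.ω u x := h1
      _ ≤ N.pathWeight p + γ.d v + N.ω u x := by gcongr
      _ = N.ω u x + N.pathWeight p + γ.d v := by ring

theorem Terminal.legitimate [Finite V] {γ : Config N} (h : γ.Terminal) : γ.Legitimate := by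
  intro u
  by_cases hu : u = N.root
  · exact Or.inl hu
  refine Or.inr ?_
  by_cases hr : u ∈ N.component N.root
  · have hr' : N.graph.Reachable N.root u := hr
    obtain ⟨p⟩ := hr'.symm
    have hC := (h.d_le_pathWeight p γ.st_root).1
    obtain ⟨v, hv, -, hd⟩ := h.exists_parent hu hC
    refine Or.inl ⟨hu, hr, hC, le_antisymm ?_ ?_, v, hv, hd⟩
    · refine le_iInf fun q => ?_
      have := (h.d_le_pathWeight q γ.st_root).2
      rw [γ.d_root, add_zero] at this
      exact_mod_cast this
    · obtain ⟨q, hq⟩ := h.exists_walk hC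
      exact hq ▸ iInf_le _ q
  · refine Or.inr ⟨hr, ?_⟩
    cases hs : γ.st u
    · rfl
    · obtain ⟨p, -⟩ := h.exists_walk hs
      exact absurd p.reachable.symm hr
    · exact absurd hs (h.st_ne_EB u)
    · exact absurd hs (h.st_ne_EF u)

end Config

/-! ### From moves to steps -/

theorem exists_weight (hw : ∀ e ∈ N.graph.edgeSet, ∀ e' ∈ N.graph.edgeSet,
    N.weight e = N.weight e') : ∃ w : ℝ≥0, ∀ x y, N.graph.Adj x y → N.ω x y = w := by
  by_cases h : N.graph.edgeSet.Nonempty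
  · obtain ⟨e, he⟩ := h
    exact ⟨N.weight e, fun x y hxy => hw _ hxy _ he⟩
  · exact ⟨0, fun x y hxy => absurd ⟨s(x, y), hxy⟩ h⟩

theorem nMaxCC_le [Fintype V] (N : Network V Lbl) : N.nMaxCC ≤ Fintype.card V - 1 := by
  refine Finset.sup_le fun u _ => ?_
  refine (Set.ncard_le_ncard (Set.sdiff_subset_sdiff_left (Set.subset_univ _))
    (Set.toFinite _)).trans ?_
  rw [Set.ncard_sdiff_singleton_of_mem (Set.mem_univ _), Set.ncard_univ, Nat.card_eq_fintype_card]

/-- The number of steps of a sequence of steps. -/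
theorem length_le [Fintype V] (hw : ∀ e ∈ N.graph.edgeSet, ∀ e' ∈ N.graph.edgeSet,
    N.weight e = N.weight e') {c : ℕ → Config N} {j : ℕ}
    (hstep : ∀ k < j, (c k).Step (c (k + 1))) :
    j ≤ (N.nMaxCC ^ 3 + 2 * N.nMaxCC + 3) * (Fintype.card V - 1) := by
  classical
  obtain ⟨w, hw⟩ := exists_weight hw
  have hmoves : ∀ u ∈ Finset.univ.erase N.root,
      moveCount c u 0 j ≤ N.nMaxCC ^ 3 + 2 * N.nMaxCC + 3 := by
    intro u hu
    refine moveCount_le_cube (K := N.component u) (fun k hk => (hstep k hk).weakStep) ?_ hw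
      (SimpleGraph.Reachable.refl u) (Finset.ne_of_mem_erase hu) ?_
    · exact fun x y hxy hx => SimpleGraph.Reachable.trans hx hxy.reachable
    · exact Finset.le_sup (f := fun u : V => (N.component u \ {N.root}).ncard) (Finset.mem_univ u)
  -- Every step contains a move, so the total number of moves bounds the number of steps.
  have hcover : Finset.range j ⊆ (Finset.univ.erase N.root).biUnion fun u =>
      (Finset.Ico 0 j).filter fun k => (c k).Move (c (k + 1)) u := by
    intro k hk
    obtain ⟨u, hu⟩ := (hstep k (Finset.mem_range.1 hk)).exists_move
    simp only [Finset.mem_biUnion, Finset.mem_filter, Finset.mem_Ico]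
    exact ⟨u, by simp [hu.ne_root], ⟨Nat.zero_le _, Finset.mem_range.1 hk⟩, hu⟩
  calc j = (Finset.range j).card := (Finset.card_range j).symm
    _ ≤ ∑ u ∈ Finset.univ.erase N.root, moveCount c u 0 j :=
      (Finset.card_le_card hcover).trans Finset.card_biUnion_le
    _ ≤ (Finset.univ.erase N.root).card * (N.nMaxCC ^ 3 + 2 * N.nMaxCC + 3) :=
      Finset.sum_le_card_nsmul _ _ _ hmoves
    _ = _ := by
      rw [Finset.card_erase_of_mem (Finset.mem_univ _), Finset.card_univ, mul_comm]

end RSP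

theorem mainTheorem4 {V Lbl : Type*} [Fintype V] (N : RSP.Network V Lbl)
    (hw : ∀ e ∈ N.graph.edgeSet, ∀ e' ∈ N.graph.edgeSet, N.weight e = N.weight e') :
    RSP.stabilizationTime N ≤
        (((N.nMaxCC ^ 3 + 2 * N.nMaxCC + 3) * (Fintype.card V - 1) : ℕ) : ℕ∞) ∧
      (2 ≤ Fintype.card V →
        (N.nMaxCC ^ 3 + 2 * N.nMaxCC + 3) * (Fintype.card V - 1) ≤ Fintype.card V ^ 4) := by
  constructor
  · refine iSup_le fun e => ?_
    have hlen : ∀ j : ℕ, (j : ℕ∞) ≤ e.len →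
        j ≤ (N.nMaxCC ^ 3 + 2 * N.nMaxCC + 3) * (Fintype.card V - 1) := fun j hj =>
      RSP.length_le hw fun k hk => e.step k (lt_of_lt_of_le (by exact_mod_cast hk) hj)
    cases hl : e.len with
    | top =>
      -- An infinite execution would have a prefix one step longer than the bound.
      exact absurd (hlen _ (by rw [hl]; exact le_top)) (Nat.not_succ_le_self _)
    | coe l =>
      have hterm := e.maximal l hl.symm
      exact (iInf₂_le l ⟨hl.ge, hterm, hterm.legitimate⟩).trans
        (by exact_mod_cast hlen l hl.ge)
  · intro h2
    obtain ⟨p, hp⟩ := Nat.exists_eq_add_of_le' (show 1 ≤ Fintype.card V by omega)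
    have hm := RSP.nMaxCC_le N
    rw [hp, Nat.add_sub_cancel] at *
    calc (N.nMaxCC ^ 3 + 2 * N.nMaxCC + 3) * p ≤ (p ^ 3 + 2 * p + 3) * p := by gcongr
      _ ≤ (p + 1) ^ 4 := by nlinarith [sq_nonneg p]
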